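/- Let $k$ be a field, let $n\ge 0$, and let $S$ be a $k$-subalgebra of the polynomial ring $k[x_1,\dots,x_n]$ generated by a set of monomials, not necessarily finite. Grade $S=\bigoplus_{i\ge 0}S_i$ by total degree, i.e. $S_i=S\cap k[x_1,\dots,x_n]_i$, and let $P_S(t)=\sum_{i\ge 0}(\dim_k S_i)\,t^i$ be its Poincaré series. Then $S$ is a Hilbert-Serre ring: it is an $\mathbb N$-graded ring with $S_0=k$, all $\dim_k S_i$ are finite, $P_S$ has radius of convergence at least $1$, and there is $d\in\mathbb N$ such that $(1-t)^dP_S(t)$ has a finite limit as $t\to 1$ from the left. Moreover, if $d(S)$ denotes the least such $d$, then $$\dim(S)=\operatorname{trdeg}_k(S)=\operatorname{GKdim}_k(S)=d(S).$$ Here $\dim(S)$ is the Krull dimension, $\operatorname{trdeg}_k(S)$ is the transcendence degree of $S$ over $k$, and $$\operatorname{GKdim}_k(S)=\sup_V\limsup_{m\to\infty}\frac{\log\dim_k(k+V+V^2+\cdots+V^m)}{\log m},$$ where $V$ runs over the finite-dimensional $k$-subspaces of $S$ and $V^i$ is the $k$-span of all products of $i$ elements of $V$. -/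

import Mathlib

open Filter Topology

noncomputable section

/-- `k + V + V ^ 2 + ⋯ + V ^ n`, where `V ^ i` is the `k`-span of all products of `i` elements of
`V` (and `V ^ 0` is the image of `k`). -/
def powerSum {k A : Type*} [Field k] [CommRing A] [Algebra k A]
    (V : Submodule k A) (n : ℕ) : Submodule k A :=
  ∑ i ∈ Finset.range (n + 1), V ^ i

/-- The Gelfand-Kirillov dimension of a commutative `k`-algebra, as an extended real number:
the supremum, over the finite-dimensional subspaces `V`, of
`limsup_{n → ∞} log (dim_k (k + V + ⋯ + V ^ n)) / log n`. -/
def gkDim (k A : Type*) [Field k] [CommRing A] [Algebra k A] : EReal :=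
  ⨆ V : {V : Submodule k A // FiniteDimensional k V},
    limsup (fun n : ℕ =>
      ((Real.log (Module.finrank k (powerSum V.1 n)) / Real.log n : ℝ) : EReal)) atTop

/-- The Poincaré series `∑ (dim_k R_n) t ^ n` of the family `R_n = 𝒜 n`, as a function of a real
variable. -/
def poincareSeries {k A : Type*} [Field k] [CommRing A] [Algebra k A]
    (𝒜 : ℕ → Submodule k A) (t : ℝ) : ℝ :=
  ∑' n : ℕ, (Module.finrank k (𝒜 n) : ℝ) * t ^ n

/-- The radius of convergence of the Poincaré series. -/
def poincareRadius {k A : Type*} [Field k] [CommRing A] [Algebra k A]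
    (𝒜 : ℕ → Submodule k A) : ENNReal :=
  (FormalMultilinearSeries.ofScalars ℝ
    (fun n : ℕ => (Module.finrank k (𝒜 n) : ℝ))).radius

/-- The set of all natural numbers `d` such that `(1 - t) ^ d * P(t)` has a finite limit as `t`
tends to `1` from the left, where `P` is the Poincaré series. -/
def poleBounds {k A : Type*} [Field k] [CommRing A] [Algebra k A]
    (𝒜 : ℕ → Submodule k A) : Set ℕ :=
  {d : ℕ | ∃ L : ℝ, Tendsto (fun t : ℝ => (1 - t) ^ d * poincareSeries 𝒜 t) (𝓝[<] 1) (𝓝 L)}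

/-- `A`, with homogeneous components `𝒜 n`, is a Hilbert-Serre ring: an `ℕ`-graded ring with degree
zero part the field `k`, with finite-dimensional homogeneous components, whose Poincaré series
converges on the open unit disc and has a pole of finite order at `1`.
The radius of convergence is at most `1` as soon as infinitely many components are nonzero, so
`1 ≤ radius` says that it is `1`, except if `A` is finite-dimensional, where it is infinite. -/
structure IsHilbertSerre {k A : Type*} [Field k] [CommRing A] [Algebra k A]
    (𝒜 : ℕ → Submodule k A) : Prop where
  nontrivial : Nontrivial A
  gradedMonoid : SetLike.GradedMonoid 𝒜
  isInternal : DirectSum.IsInternal 𝒜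
  zero_eq : 𝒜 0 = 1
  finite : ∀ n, FiniteDimensional k (𝒜 n)
  one_le_radius : 1 ≤ poincareRadius 𝒜
  poleBounds_nonempty : (poleBounds 𝒜).Nonempty

/-- The Hilbert-Serre dimension: the least `d` for which `(1 - t) ^ d * P(t)` has a finite limit as
`t` tends to `1` from the left (meaningful for Hilbert-Serre rings). -/
def hilbertSerreDim {k A : Type*} [Field k] [CommRing A] [Algebra k A]
    (𝒜 : ℕ → Submodule k A) : ℕ :=
  sInf (poleBounds 𝒜)

/-- A subalgebra of the polynomial ring in `n` variables that is generated by a (finite or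
infinite) set of monomials. -/
def IsMonomialAlgebra {k : Type*} [Field k] {n : ℕ}
    (S : Subalgebra k (MvPolynomial (Fin n) k)) : Prop :=
  ∃ E : Set (Fin n →₀ ℕ), S = Algebra.adjoin k ((fun e => MvPolynomial.monomial e (1 : k)) '' E)

/-- The homogeneous components `S_i = S ∩ k[x_1, …, x_n]_i` of a subalgebra of the polynomial ring
with its standard grading, as subspaces of `S`. -/
def standardGrading {k : Type*} [Field k] {n : ℕ}
    (S : Subalgebra k (MvPolynomial (Fin n) k)) (i : ℕ) : Submodule k S :=
  (MvPolynomial.homogeneousSubmodule (Fin n) k i).comap S.val.toLinearMap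

end

/-!
Let `M` be the monoid of exponents of the monomials in `S`, and let `r` be the dimension of its real
span. Two estimates show that all the invariants are equal to `r`.

* A chain of subspaces spanned by more and more of `r` linearly independent exponents of `M` gives a
  chain of primes in `S`: identify monomials whose exponents agree modulo the subspace. Hence
  `r ≤ dim S`. Moreover `dim ≤ trdeg ≤ GKdim` for every commutative algebra over a field.
* The number of elements of `M` of degree at most `N` is asymptotic to `c N ^ r` with `c > 0`, the
  normalised volume of the part of degree at most `1` of the cone over `M`. If `M` is not finitely
  generated, the lower bound comes from an exhaustion of this cone by finitely generated cones: such
  a cone has a translate by an element of `M` all of whose points in the lattice spanned by `M` are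
  in `M`. This growth rate bounds `GKdim S` by `r`, and by an Abelian theorem it makes
  `(1 - t) ^ r P_S(t)` tend to a positive limit.
-/

section TranscendenceDegree

theorem transcendental_of_map_eq_zero {R A B : Type*} [CommRing R] [CommRing A] [CommRing B]
    [Algebra R A] (f : A →+* B) (hf : Function.Injective (f.comp (algebraMap R A))) {x : A}
    (hx : x ∈ nonZeroDivisors A) (hfx : f x = 0) : Transcendental R x := by
  rw [transcendental_iff]
  intro p hp
  by_contra hp0
  -- Cancelling powers of `x` leaves a relation with nonzero constant term, which `f` must kill.
  obtain ⟨q, hpq, hq⟩ := p.exists_eq_pow_rootMultiplicity_mul_and_not_dvd hp0 0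
  rw [Polynomial.C_0, sub_zero] at hpq hq
  have hqx : Polynomial.aeval x q = 0 := by
    rw [hpq, map_mul, map_pow, Polynomial.aeval_X] at hp
    exact (pow_mem hx _).1 _ hp
  have hq0 : f.comp (algebraMap R A) (q.coeff 0) = 0 := by
    have h : f (Polynomial.aeval x q) = 0 := by rw [hqx, map_zero]
    rwa [Polynomial.aeval_def, Polynomial.hom_eval₂, hfx, Polynomial.eval₂_at_zero] at h
  exact hq (Polynomial.X_dvd_iff.2 ((map_eq_zero_iff _ hf).1 hq0))

universe u v

variable {k : Type u} [Field k]

theorem algebraicIndependent_option_of_map {ι A B : Type*} [CommRing A] [CommRing B]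
    [Algebra k A] [Algebra k B] (f : A →ₐ[k] B) {y : ι → A}
    (hy : AlgebraicIndependent k (f ∘ y)) {x : A} (hx : x ∈ nonZeroDivisors A) (hfx : f x = 0) :
    AlgebraicIndependent k fun o : Option ι => o.elim x y := by
  rw [(AlgebraicIndependent.of_comp f hy).option_iff_transcendental]
  refine transcendental_of_map_eq_zero (f : A →+* B) ?_ hx hfx
  rw [injective_iff_map_eq_zero]
  rintro ⟨a, ha⟩ h
  rw [Algebra.adjoin_range_eq_range_aeval] at ha
  obtain ⟨p, rfl⟩ := ha
  have hp : MvPolynomial.aeval (f ∘ y) p = 0 := by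
    exact (MvPolynomial.comp_aeval_apply y f p).symm.trans h
  exact Subtype.ext (by simp [hy.eq_zero_of_aeval_eq_zero p hp])

theorem trdeg_add_one_le_of_surjective {A B : Type v} [CommRing A] [CommRing B] [IsDomain B]
    [Algebra k A] [Algebra k B] (f : A →ₐ[k] B) (hf : Function.Surjective f) {x : A}
    (hx : x ∈ nonZeroDivisors A) (hfx : f x = 0) :
    Algebra.trdeg k B + 1 ≤ Algebra.trdeg k A := by
  obtain ⟨ι, y, hy⟩ := exists_isTranscendenceBasis' k B
  have hy' : AlgebraicIndependent k (f ∘ (Function.surjInv hf ∘ y)) := by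
    rw [← Function.comp_assoc, (Function.rightInverse_surjInv hf).comp_eq_id]
    exact hy.1
  rw [← hy.cardinalMk_eq_trdeg, ← Cardinal.mk_option]
  exact (algebraicIndependent_option_of_map f hy' hx hfx).cardinalMk_le_trdeg

theorem natCast_le_trdeg_quotient_of_strictMono {A : Type v} [CommRing A] [Algebra k A] {l : ℕ}
    (p : Fin (l + 1) → PrimeSpectrum A) (hp : StrictMono p) :
    (l : Cardinal) ≤ Algebra.trdeg k (A ⧸ (p 0).asIdeal) := by
  induction l with
  | zero => simp
  | succ l ih =>
    have hlt : (p 0).asIdeal < (p 1).asIdeal := hp Fin.zero_lt_one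
    obtain ⟨x, hx1, hx0⟩ := SetLike.exists_of_lt hlt
    have hx : Ideal.Quotient.mk (p 0).asIdeal x ∈ nonZeroDivisors (A ⧸ (p 0).asIdeal) :=
      mem_nonZeroDivisors_of_ne_zero (mt Ideal.Quotient.eq_zero_iff_mem.1 hx0)
    calc ((l + 1 : ℕ) : Cardinal)
        ≤ Algebra.trdeg k (A ⧸ (p 1).asIdeal) + 1 := by
          push_cast
          gcongr
          exact ih (p ∘ Fin.succ) (hp.comp Fin.strictMono_succ)
      _ ≤ Algebra.trdeg k (A ⧸ (p 0).asIdeal) :=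
          trdeg_add_one_le_of_surjective (Ideal.Quotient.factorₐ k hlt.le)
            (Ideal.Quotient.factor_surjective hlt.le) hx (Ideal.Quotient.eq_zero_iff_mem.2 hx1)

theorem natCast_le_trdeg_of_le_ringKrullDim {A : Type v} [CommRing A] [Algebra k A] {l : ℕ}
    (h : (l : WithBot ℕ∞) ≤ ringKrullDim A) : (l : Cardinal) ≤ Algebra.trdeg k A := by
  obtain ⟨c, rfl⟩ := Order.le_krullDim_iff.1 h
  exact (natCast_le_trdeg_quotient_of_strictMono c c.strictMono).trans
    (trdeg_le_of_surjective (Ideal.Quotient.mkₐ k _) (Ideal.Quotient.mkₐ_surjective k _))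

theorem exists_algebraicIndependent_of_le_trdeg {A : Type v} [CommRing A] [Nontrivial A]
    [Algebra k A] {s : ℕ} (h : (s : Cardinal) ≤ Algebra.trdeg k A) :
    ∃ y : Fin s → A, AlgebraicIndependent k y := by
  obtain _ | s := s
  · exact ⟨Fin.elim0, algebraicIndependent_empty_type⟩
  have hs : (s : Cardinal) < Algebra.trdeg k A := (Nat.cast_lt.2 s.lt_succ_self).trans_le h
  obtain ⟨⟨t, ht⟩, hst⟩ := exists_lt_of_lt_ciSup' hs
  have hcard : Cardinal.lift.{v, 0} (Cardinal.mk (Fin (s + 1))) ≤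
      Cardinal.lift.{0, v} (Cardinal.mk t) := by
    simpa using! Order.succ_le_of_lt hst
  obtain ⟨g⟩ := Cardinal.lift_mk_le'.1 hcard
  exact ⟨_, ht.comp g g.injective⟩

theorem linearIndependent_prod_pow {k A ι : Type*} [CommRing k] [CommRing A] [Algebra k A]
    [Fintype ι] {y : ι → A} (hy : AlgebraicIndependent k y) :
    LinearIndependent k fun a : ι → ℕ => ∏ i, y i ^ a i := by
  have h := ((MvPolynomial.basisMonomials ι k).linearIndependent.comp _
    Finsupp.equivFunOnFinite.symm.injective).map' (MvPolynomial.aeval y).toLinearMap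
    (LinearMap.ker_eq_bot.2 hy)
  convert! h using 2 with a
  simp [MvPolynomial.aeval_monomial, Finsupp.prod_fintype]

end TranscendenceDegree

section GKDim

variable {k A : Type*} [Field k] [CommRing A] [Algebra k A]

theorem pow_le_powerSum (V : Submodule k A) (n : ℕ) : V ^ n ≤ powerSum V n :=
  Finset.single_le_sum (f := fun i => V ^ i) (fun _ _ => bot_le) (Finset.self_mem_range_succ n)

theorem finiteDimensional_powerSum {V : Submodule k A} (hV : V.FG) (n : ℕ) :
    FiniteDimensional k (powerSum V n) := by
  refine Module.Finite.iff_fg.2 ?_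
  exact Finset.sum_induction _ Submodule.FG (fun _ _ => Submodule.FG.sup) Submodule.fg_bot
    fun i _ => hV.pow i

theorem prod_pow_mem_prod_pow {ι : Type*} [Fintype ι] {W : ι → Submodule k A} (hW : ∀ i, 1 ≤ W i)
    {y : ι → A} (hy : ∀ i, y i ∈ W i) {n : ℕ} {a : ι → ℕ} (ha : ∀ i, a i ≤ n) :
    ∏ i, y i ^ a i ∈ (∏ i, W i) ^ n := by
  classical
  rw [← Finset.prod_pow]
  induction (Finset.univ : Finset ι) using Finset.induction_on with
  | empty => exact Submodule.one_le.1 le_rfl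
  | insert i t hi ih =>
    rw [Finset.prod_insert hi, Finset.prod_insert hi]
    exact Submodule.mul_mem_mul
      (pow_le_pow_right₀ (hW i) (ha i) (Submodule.pow_mem_pow _ (hy i) _)) ih

theorem natCast_le_gkDim_of_eventually_le {r : ℕ} (V : Submodule k A) [FiniteDimensional k V]
    (h : ∀ᶠ n : ℕ in atTop, n ^ r ≤ Module.finrank k (powerSum V n)) : r ≤ gkDim k A := by
  refine le_iSup_of_le ⟨V, ‹_›⟩ (le_limsup_of_frequently_le' (Eventually.frequently ?_))
  filter_upwards [h, eventually_ge_atTop 2] with n hn hn2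
  have hlog : 0 < Real.log n := Real.log_pos (by exact_mod_cast hn2)
  rw [← EReal.coe_natCast, EReal.coe_le_coe_iff, le_div_iff₀ hlog, ← Real.log_pow]
  exact Real.log_le_log (by positivity) (by exact_mod_cast hn)

theorem gkDim_le_of_eventually_le {r : ℕ}
    (h : ∀ V : Submodule k A, FiniteDimensional k V → ∃ C : ℝ,
      ∀ᶠ n : ℕ in atTop, (Module.finrank k (powerSum V n) : ℝ) ≤ C * (n : ℝ) ^ r) :
    gkDim k A ≤ r := by
  refine iSup_le fun ⟨V, hV⟩ => ?_
  obtain ⟨C, hC⟩ := h V hV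
  have hlim : Tendsto (fun n : ℕ => ((r + Real.log (max C 1) / Real.log n : ℝ) : EReal)) atTop
      (𝓝 (r : EReal)) := by
    have hdiv := (tendsto_const_nhds (x := Real.log (max C 1))).div_atTop
      (Real.tendsto_log_atTop.comp tendsto_natCast_atTop_atTop)
    simpa [Function.comp_def] using
      (continuous_coe_real_ereal.tendsto _).comp (hdiv.const_add (r : ℝ))
  rw [← hlim.limsup_eq]
  refine limsup_le_limsup ?_
  filter_upwards [hC, eventually_ge_atTop 2] with n hn hn2
  have hn1 : (1 : ℝ) < n := by exact_mod_cast hn2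
  have hlog : 0 < Real.log n := Real.log_pos hn1
  have hbound : max 1 (Module.finrank k (powerSum V n) : ℝ) ≤ (n : ℝ) ^ r * max C 1 := by
    rw [mul_comm]
    refine max_le
      (one_le_mul_of_one_le_of_one_le (le_max_right _ _) (one_le_pow₀ hn1.le)) (hn.trans ?_)
    gcongr
    exact le_max_left _ _
  rw [EReal.coe_le_coe_iff, div_le_iff₀ hlog, add_mul, div_mul_cancel₀ _ hlog.ne', ← Real.log_pow,
    ← Real.log_mul (by positivity) (by positivity)]
  rcases (Module.finrank k (powerSum V n)).eq_zero_or_pos with h0 | h0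
  · rw [h0, Nat.cast_zero, Real.log_zero]
    exact Real.log_nonneg ((le_max_left _ _).trans hbound)
  · exact Real.log_le_log (by exact_mod_cast h0) ((le_max_right _ _).trans hbound)

theorem natCast_le_gkDim_of_algebraicIndependent {ι : Type*} [Fintype ι] {y : ι → A}
    (hy : AlgebraicIndependent k y) : (Fintype.card ι : EReal) ≤ gkDim k A := by
  classical
  set V : Submodule k A := ∏ i, Submodule.span k {1, y i}
  have hone : (1 : Submodule k A).FG := Submodule.one_eq_span (R := k) (A := A) ▸
    Submodule.fg_span_singleton _
  have hV : V.FG := Finset.prod_induction _ Submodule.FG (fun _ _ => Submodule.FG.mul) hone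
    fun _ _ => Submodule.fg_span (Set.toFinite _)
  have := Module.Finite.iff_fg.2 hV
  refine natCast_le_gkDim_of_eventually_le V (.of_forall fun n => ?_)
  have := finiteDimensional_powerSum hV n
  have hmem (a : ι → Fin n) : ∏ i, y i ^ (a i : ℕ) ∈ powerSum V n :=
    pow_le_powerSum V n <| prod_pow_mem_prod_pow
      (fun i => Submodule.one_le.2 (Submodule.subset_span (by simp)))
      (fun i => Submodule.subset_span (by simp)) fun i => (a i).2.le
  have hli : LinearIndependent k fun a : ι → Fin n => (⟨_, hmem a⟩ : powerSum V n) :=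
    .of_comp (powerSum V n).subtype <| (linearIndependent_prod_pow hy).comp
      (fun (a : ι → Fin n) i => (a i : ℕ)) fun a b hab => funext fun i => Fin.ext (congrFun hab i)
  simpa using hli.fintype_card_le_finrank

theorem natCast_le_gkDim_of_le_trdeg [Nontrivial A] {r : ℕ}
    (h : (r : Cardinal) ≤ Algebra.trdeg k A) : r ≤ gkDim k A := by
  obtain ⟨y, hy⟩ := exists_algebraicIndependent_of_le_trdeg h
  simpa using natCast_le_gkDim_of_algebraicIndependent hy

theorem ringKrullDim_trdeg_gkDim_eq [Nontrivial A] {r : ℕ} (hr : r ≤ ringKrullDim A)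
    (hr' : gkDim k A ≤ r) :
    ringKrullDim A = r ∧ Algebra.trdeg k A = r ∧ gkDim k A = r := by
  have not_le : ¬ ((r + 1 : ℕ) : EReal) ≤ gkDim k A := fun h =>
    r.lt_succ_self.not_ge (by exact_mod_cast h.trans hr')
  have htr : (r : Cardinal) ≤ Algebra.trdeg k A := natCast_le_trdeg_of_le_ringKrullDim hr
  have htr' : Algebra.trdeg k A ≤ r := by
    by_contra! h
    exact not_le (natCast_le_gkDim_of_le_trdeg (by simpa using! Order.succ_le_of_lt h))
  refine ⟨le_antisymm ?_ hr, le_antisymm htr' htr,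
    le_antisymm hr' (natCast_le_gkDim_of_le_trdeg htr)⟩
  by_contra! h
  have hsucc : ((r + 1 : ℕ) : WithBot ℕ∞) ≤ ringKrullDim A := by
    exact_mod_cast ENat.WithBot.add_one_le_iff.2 h
  have htr_succ := (natCast_le_trdeg_of_le_ringKrullDim (k := k) hsucc).trans htr'
  exact r.lt_succ_self.not_ge (by exact_mod_cast htr_succ)

end GKDim

section PowerSeries

open Asymptotics

theorem tendsto_choose_div_pow (r : ℕ) :
    Tendsto (fun n : ℕ => ((n + r).choose r : ℝ) / (n : ℝ) ^ r) atTop (𝓝 (1 / r.factorial)) := by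
  induction r with
  | zero => simp
  | succ r ih =>
    have hratio : Tendsto (fun n : ℕ => (n + (r + 1) : ℝ) / n) atTop (𝓝 1) := by
      have h := (tendsto_const_div_atTop_nhds_zero_nat (r + 1 : ℝ)).const_add 1
      rw [add_zero] at h
      refine h.congr' ?_
      filter_upwards [eventually_ne_atTop 0] with n hn
      field_simp
    have h := (ih.mul hratio).div_const (r + 1 : ℝ)
    rw [show (1 : ℝ) / r.factorial * 1 / (r + 1) = 1 / (r + 1).factorial by
      rw [Nat.factorial_succ]; push_cast; field_simp] at h
    refine h.congr fun n => ?_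
    have hchoose : ((n + (r + 1)).choose (r + 1) : ℝ) * (r + 1) =
        (n + r + 1) * (n + r).choose r := by
      exact_mod_cast (Nat.add_one_mul_choose_eq (n + r) r).symm
    rw [eq_div_of_mul_eq (by positivity) hchoose]
    ring

theorem summable_mul_pow_of_tendsto_div_pow {u : ℕ → ℝ} {r : ℕ} {c : ℝ}
    (hu : Tendsto (fun n : ℕ => u n / (n : ℝ) ^ r) atTop (𝓝 c)) {t : ℝ} (ht : |t| < 1) :
    Summable fun n => u n * t ^ n := by
  have hO : u =O[atTop] fun n : ℕ => (n : ℝ) ^ r := by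
    refine isBigO_of_div_tendsto_nhds ?_ c hu
    filter_upwards [eventually_ne_atTop 0] with n hn h
    exact absurd h (by positivity)
  exact summable_of_isBigO_nat (summable_pow_mul_geometric_of_norm_lt_one r ht)
    (hO.mul (isBigO_refl _ _))

theorem isLittleO_tsum_mul_pow {u b : ℕ → ℝ} (hb : ∀ n, 0 ≤ b n)
    (hsum : ∀ t ∈ Set.Ioo (0 : ℝ) 1, Summable fun n => b n * t ^ n)
    (htop : Tendsto (fun t : ℝ => ∑' n, b n * t ^ n) (𝓝[<] 1) atTop) (hub : u =o[atTop] b) :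
    (fun t : ℝ => ∑' n, u n * t ^ n) =o[𝓝[<] 1] fun t : ℝ => ∑' n, b n * t ^ n := by
  refine isLittleO_iff.2 fun ε hε => ?_
  obtain ⟨N, hN⟩ := eventually_atTop.1 (isLittleO_iff.1 hub (half_pos hε))
  set K := ∑ n ∈ Finset.range N, |u n|
  set w : ℕ → ℝ := fun n => if n ∈ Finset.range N then |u n| else 0
  have huw (n : ℕ) : |u n| ≤ w n + ε / 2 * b n := by
    by_cases hn : n < N
    · have := mul_nonneg (half_pos hε).le (hb n)
      simpa [w, hn] using this
    · simpa [w, hn, abs_of_nonneg (hb n)] using hN n (not_lt.1 hn)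
  filter_upwards [htop.eventually_ge_atTop (K / (ε / 2)), Ioo_mem_nhdsLT (zero_lt_one' ℝ)]
    with t hK ht
  have hw : HasSum (fun n => w n * t ^ n) (∑ n ∈ Finset.range N, w n * t ^ n) :=
    hasSum_sum_of_ne_finset_zero fun n hn => by simp only [w, if_neg hn, zero_mul]
  have hwK : ∑ n ∈ Finset.range N, w n * t ^ n ≤ K := Finset.sum_le_sum fun n hn => by
    simp only [w, if_pos hn]
    exact mul_le_of_le_one_right (abs_nonneg _) (pow_le_one₀ ht.1.le ht.2.le)
  have hbt : 0 ≤ ∑' n, b n * t ^ n := tsum_nonneg fun n => mul_nonneg (hb n) (pow_nonneg ht.1.le n)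
  calc ‖∑' n, u n * t ^ n‖
      ≤ ∑ n ∈ Finset.range N, w n * t ^ n + ε / 2 * ∑' n, b n * t ^ n := by
        refine tsum_of_norm_bounded (hw.add ((hsum t ht).hasSum.mul_left (ε / 2))) fun n => ?_
        rw [Real.norm_eq_abs, abs_mul, abs_of_nonneg (pow_nonneg ht.1.le n), ← mul_assoc, ← add_mul]
        exact mul_le_mul_of_nonneg_right (huw n) (pow_nonneg ht.1.le n)
    _ ≤ ε / 2 * ∑' n, b n * t ^ n + ε / 2 * ∑' n, b n * t ^ n := by
        gcongr
        exact hwK.trans ((div_le_iff₀' (half_pos hε)).1 hK)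
    _ = ε * ‖∑' n, b n * t ^ n‖ := by rw [Real.norm_of_nonneg hbt]; ring

theorem tendsto_inv_one_sub_pow_succ_atTop (r : ℕ) :
    Tendsto (fun t : ℝ => ((1 - t) ^ (r + 1))⁻¹) (𝓝[<] 1) atTop := by
  have hcont : Continuous fun t : ℝ => (1 - t) ^ (r + 1) := by fun_prop
  refine Tendsto.inv_tendsto_nhdsGT_zero (tendsto_nhdsWithin_iff.2 ⟨?_, ?_⟩)
  · simpa using (hcont.tendsto 1).mono_left (nhdsWithin_le_nhds (s := Set.Iio (1 : ℝ)))
  · filter_upwards [self_mem_nhdsWithin] with t ht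
    exact pow_pos (sub_pos.2 (Set.mem_Iio.1 ht)) _

theorem isLittleO_sub_mul_choose {u : ℕ → ℝ} {r : ℕ} {c : ℝ}
    (hu : Tendsto (fun n : ℕ => u n / (n : ℝ) ^ r) atTop (𝓝 c)) :
    (fun n => u n - c * r.factorial * (n + r).choose r) =o[atTop]
      fun n => ((n + r).choose r : ℝ) := by
  have hpos (n : ℕ) : (0 : ℝ) < (n + r).choose r :=
    Nat.cast_pos.2 (Nat.choose_pos (Nat.le_add_left r n))
  refine (isLittleO_iff_tendsto fun n h => absurd h (hpos n).ne').2 ?_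
  have h := hu.div (tendsto_choose_div_pow r) (by positivity)
  rw [div_div_eq_mul_div, div_one] at h
  have hlim : Tendsto (fun n => u n / (n + r).choose r) atTop (𝓝 (c * r.factorial)) := by
    refine h.congr' ?_
    filter_upwards [eventually_ne_atTop 0] with n hn
    exact div_div_div_cancel_right₀ (by positivity) _ _
  simpa [sub_div, (hpos _).ne'] using hlim.sub_const (c * r.factorial)

theorem tendsto_one_sub_pow_mul_tsum {u : ℕ → ℝ} {r : ℕ} {c : ℝ}
    (hu : Tendsto (fun n : ℕ => u n / (n : ℝ) ^ r) atTop (𝓝 c)) :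
    Tendsto (fun t : ℝ => (1 - t) ^ (r + 1) * ∑' n, u n * t ^ n) (𝓝[<] 1)
      (𝓝 (c * r.factorial)) := by
  set b : ℕ → ℝ := fun n => ((n + r).choose r : ℝ)
  have habs {t : ℝ} (ht : t ∈ Set.Ioo (0 : ℝ) 1) : |t| < 1 := abs_lt.2 ⟨by linarith [ht.1], ht.2⟩
  have hb {t : ℝ} (ht : t ∈ Set.Ioo (0 : ℝ) 1) :
      HasSum (fun n => b n * t ^ n) ((1 - t) ^ (r + 1))⁻¹ := by
    simpa [b] using hasSum_choose_mul_geometric_of_norm_lt_one (𝕜 := ℝ) r (habs ht)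
  have hIoo : Set.Ioo (0 : ℝ) 1 ∈ 𝓝[<] 1 := Ioo_mem_nhdsLT zero_lt_one
  have htop : Tendsto (fun t : ℝ => ∑' n, b n * t ^ n) (𝓝[<] 1) atTop := by
    refine (tendsto_inv_one_sub_pow_succ_atTop r).congr' ?_
    filter_upwards [hIoo] with t ht using (hb ht).tsum_eq.symm
  have h := (isLittleO_tsum_mul_pow (fun n => Nat.cast_nonneg _) (fun t ht => (hb ht).summable) htop
    (isLittleO_sub_mul_choose hu)).tendsto_div_nhds_zero.add_const (c * r.factorial)
  rw [zero_add] at h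
  refine h.congr' ?_
  filter_upwards [hIoo] with t ht
  have hsub : ∑' n, (u n - c * r.factorial * b n) * t ^ n
      = ∑' n, u n * t ^ n - c * r.factorial * ((1 - t) ^ (r + 1))⁻¹ := by
    rw [← (((summable_mul_pow_of_tendsto_div_pow hu (habs ht)).hasSum.sub
      ((hb ht).mul_left _)).tsum_eq)]
    simp only [sub_mul, mul_assoc]
  have ht' : 1 - t ≠ 0 := (sub_pos.2 ht.2).ne'
  rw [hsub, (hb ht).tsum_eq]
  field_simp
  ring

section PartialSums

variable {a : ℕ → ℝ} {r : ℕ} {c : ℝ}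

theorem summable_mul_pow_of_tendsto_sum_div_pow (ha : ∀ n, 0 ≤ a n)
    (h : Tendsto (fun n : ℕ => (∑ i ∈ Finset.range (n + 1), a i) / (n : ℝ) ^ r) atTop (𝓝 c))
    {t : ℝ} (ht₀ : 0 ≤ t) (ht₁ : t < 1) : Summable fun n => a n * t ^ n := by
  refine .of_nonneg_of_le (fun n => mul_nonneg (ha n) (pow_nonneg ht₀ n)) (fun n => ?_)
    (summable_mul_pow_of_tendsto_div_pow h (abs_lt.2 ⟨by linarith, ht₁⟩))
  gcongr
  exact Finset.single_le_sum (fun i _ => ha i) (Finset.self_mem_range_succ n)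

theorem tsum_sum_range_mul_pow (a : ℕ → ℝ) {t : ℝ} (ht : |t| < 1)
    (h : Summable fun n => ‖a n * t ^ n‖) :
    ∑' n, (∑ i ∈ Finset.range (n + 1), a i) * t ^ n = (∑' n, a n * t ^ n) * (1 - t)⁻¹ := by
  rw [← tsum_geometric_of_norm_lt_one ht, tsum_mul_tsum_eq_tsum_sum_range_of_summable_norm h
    (summable_norm_geometric_of_norm_lt_one ht)]
  refine tsum_congr fun n => ?_
  rw [Finset.sum_mul]
  refine Finset.sum_congr rfl fun i hi => ?_
  rw [mul_assoc, ← pow_add, Nat.add_sub_cancel' (Nat.lt_succ_iff.1 (Finset.mem_range.1 hi))]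

theorem tendsto_one_sub_pow_mul_tsum_of_sum (ha : ∀ n, 0 ≤ a n)
    (h : Tendsto (fun n : ℕ => (∑ i ∈ Finset.range (n + 1), a i) / (n : ℝ) ^ r) atTop (𝓝 c)) :
    Tendsto (fun t : ℝ => (1 - t) ^ r * ∑' n, a n * t ^ n) (𝓝[<] 1) (𝓝 (c * r.factorial)) := by
  refine (tendsto_one_sub_pow_mul_tsum h).congr' ?_
  filter_upwards [Ioo_mem_nhdsLT (zero_lt_one' ℝ)] with t ht
  have ht' : 1 - t ≠ 0 := (sub_pos.2 ht.2).ne'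
  rw [tsum_sum_range_mul_pow a (abs_lt.2 ⟨by linarith [ht.1], ht.2⟩)
    (summable_mul_pow_of_tendsto_sum_div_pow ha h ht.1.le ht.2).norm, pow_succ]
  field_simp

theorem exists_tendsto_one_sub_pow_mul_iff {f : ℝ → ℝ} {L : ℝ} (hL : L ≠ 0)
    (hf : Tendsto (fun t => (1 - t) ^ r * f t) (𝓝[<] 1) (𝓝 L)) (d : ℕ) :
    (∃ L' : ℝ, Tendsto (fun t : ℝ => (1 - t) ^ d * f t) (𝓝[<] 1) (𝓝 L')) ↔ r ≤ d := by
  have hpow (e : ℕ) : Tendsto (fun t : ℝ => (1 - t) ^ e) (𝓝[<] 1) (𝓝 (0 ^ e)) := by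
    have hcont : Continuous fun t : ℝ => (1 - t) ^ e := by fun_prop
    simpa using (hcont.tendsto 1).mono_left (nhdsWithin_le_nhds (s := Set.Iio (1 : ℝ)))
  have hmul {e d : ℕ} (hed : e ≤ d) {M : ℝ}
      (he : Tendsto (fun t => (1 - t) ^ e * f t) (𝓝[<] 1) (𝓝 M)) :
      Tendsto (fun t => (1 - t) ^ d * f t) (𝓝[<] 1) (𝓝 (0 ^ (d - e) * M)) := by
    refine ((hpow (d - e)).mul he).congr fun t => ?_
    rw [← mul_assoc, ← pow_add, Nat.sub_add_cancel hed]
  refine ⟨fun ⟨M, hM⟩ => ?_, fun hd => ⟨_, hmul hd hf⟩⟩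
  by_contra! hd
  have h0 := hmul hd.le hM
  rw [zero_pow (Nat.sub_ne_zero_of_lt hd), zero_mul] at h0
  exact hL (tendsto_nhds_unique hf h0)

theorem one_le_radius_ofScalars (h : ∀ t : ℝ, 0 ≤ t → t < 1 → Summable fun n => ‖a n‖ * t ^ n) :
    1 ≤ (FormalMultilinearSeries.ofScalars ℝ a).radius := by
  refine ENNReal.le_of_forall_nnreal_lt fun t ht =>
    FormalMultilinearSeries.le_radius_of_summable _ ?_
  simpa only [FormalMultilinearSeries.ofScalars_norm] using h t t.2 (by exact_mod_cast ht)

end PartialSums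

end PowerSeries

section SubmonoidLattice

theorem exists_mem_add_mem_of_mem_span_int {G : Type*} [AddCommGroup G] {M : AddSubmonoid G} {z : G}
    (hz : z ∈ Submodule.span ℤ (M : Set G)) : ∃ b ∈ M, b + z ∈ M := by
  induction hz using Submodule.span_induction with
  | mem x hx => exact ⟨0, M.zero_mem, by simpa using hx⟩
  | zero => exact ⟨0, M.zero_mem, by simp⟩
  | add x y _ _ hx hy =>
    obtain ⟨b, hb, hbx⟩ := hx
    obtain ⟨b', hb', hby⟩ := hy
    exact ⟨b + b', M.add_mem hb hb', by rw [add_add_add_comm]; exact M.add_mem hbx hby⟩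
  | smul n x _ hx =>
    obtain ⟨b, hb, hbx⟩ := hx
    obtain ⟨m, rfl | rfl⟩ := n.eq_nat_or_neg
    · refine ⟨m • b, M.nsmul_mem hb m, ?_⟩
      rw [natCast_zsmul, ← nsmul_add]
      exact M.nsmul_mem hbx m
    · refine ⟨m • (b + x), M.nsmul_mem hbx m, ?_⟩
      rw [neg_smul, natCast_zsmul, nsmul_add, add_neg_cancel_right]
      exact M.nsmul_mem hb m

theorem exists_mem_forall_add_mem_of_subset_span_int {G : Type*} [AddCommGroup G]
    {M : AddSubmonoid G} {Z : Set G} (hZ : Z.Finite) (hZM : Z ⊆ Submodule.span ℤ (M : Set G)) :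
    ∃ b ∈ M, ∀ z ∈ Z, b + z ∈ M := by
  induction Z, hZ using Set.Finite.induction_on with
  | empty => exact ⟨0, M.zero_mem, by simp⟩
  | @insert z Z _ _ ih =>
    obtain ⟨hz, hZM⟩ := Set.insert_subset_iff.1 hZM
    obtain ⟨b, hb, hbZ⟩ := ih hZM
    obtain ⟨b', hb', hbz⟩ := exists_mem_add_mem_of_mem_span_int hz
    refine ⟨b + b', M.add_mem hb hb', Set.forall_mem_insert.2 ⟨?_, fun w hw => ?_⟩⟩
    · rw [add_assoc]
      exact M.add_mem hb hbz
    · rw [add_right_comm]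
      exact M.add_mem (hbZ w hw) hb'

variable {E : Type*} [NormedAddCommGroup E] [NormedSpace ℝ E]

theorem exists_mem_norm_sub_le_of_mem_hull {M : AddSubmonoid E} {F : Finset E}
    (hF : (F : Set E) ⊆ M) {y : E} (hy : y ∈ PointedCone.hull ℝ (F : Set E)) :
    ∃ w ∈ M, ‖y - w‖ ≤ ∑ v ∈ F, ‖v‖ := by
  obtain ⟨l, -, rfl⟩ := Submodule.mem_span_finset.1 hy
  refine ⟨∑ v ∈ F, ⌊(l v : ℝ)⌋₊ • v, M.sum_mem fun v hv => M.nsmul_mem (hF hv) _, ?_⟩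
  have hfract : ∀ v ∈ F, l v • v - ⌊(l v : ℝ)⌋₊ • v = Int.fract (l v : ℝ) • v := fun v _ => by
    rw [← Nat.cast_smul_eq_nsmul ℝ, natCast_floor_eq_intCast_floor (l v).2, Int.fract, sub_smul,
      Nonneg.mk_smul]
  rw [← Finset.sum_sub_distrib, Finset.sum_congr rfl hfract]
  refine (norm_sum_le _ _).trans (Finset.sum_le_sum fun v _ => ?_)
  rw [norm_smul, Real.norm_of_nonneg (Int.fract_nonneg _)]
  exact mul_le_of_le_one_left (norm_nonneg _) (Int.fract_lt_one _).le

theorem finite_inter_lattice [FiniteDimensional ℝ E] (L : Submodule ℤ E) [DiscreteTopology L]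
    {s : Set E} (hs : Bornology.IsBounded s) : (s ∩ (L : Set E)).Finite := by
  have : ProperSpace E := FiniteDimensional.proper ℝ E
  have : DiscreteTopology L.toAddSubgroup := inferInstanceAs (DiscreteTopology L)
  exact Metric.finite_isBounded_inter_isClosed DiscreteTopology.isDiscrete hs
    (AddSubgroup.isClosed_of_discrete (H := L.toAddSubgroup))

open scoped Pointwise in
theorem finite_inter_inv_smul_lattice [FiniteDimensional ℝ E] (L : Submodule ℤ E)
    [DiscreteTopology L] {s : Set E} (hs : Bornology.IsBounded s) {c : ℝ} (hc : c ≠ 0) :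
    (s ∩ c⁻¹ • (L : Set E)).Finite := by
  refine ((finite_inter_lattice L (hs.smul₀ c)).smul_set (a := c⁻¹)).subset ?_
  rw [Set.smul_set_inter₀ (inv_ne_zero hc), inv_smul_smul₀ hc]

theorem exists_mem_forall_add_mem_of_mem_hull [FiniteDimensional ℝ E] {M : AddSubmonoid E}
    [DiscreteTopology (Submodule.span ℤ (M : Set E))] {F : Finset E} (hF : (F : Set E) ⊆ M) :
    ∃ x ∈ M, ∀ y ∈ PointedCone.hull ℝ (F : Set E), y ∈ Submodule.span ℤ (M : Set E) →
      x + y ∈ M := by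
  -- A lattice point of the cone is an element of `M` plus a lattice vector of bounded norm, and
  -- there are only finitely many such vectors.
  obtain ⟨x, hx, hxM⟩ := exists_mem_forall_add_mem_of_subset_span_int
    (finite_inter_lattice (Submodule.span ℤ (M : Set E))
      (Metric.isBounded_closedBall (x := 0) (r := ∑ v ∈ F, ‖v‖))) Set.inter_subset_right
  refine ⟨x, hx, fun y hy hyL => ?_⟩
  obtain ⟨w, hw, hyw⟩ := exists_mem_norm_sub_le_of_mem_hull hF hy
  rw [← sub_add_cancel y w, ← add_assoc]
  exact M.add_mem (hxM _ ⟨mem_closedBall_zero_iff.2 hyw,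
    sub_mem hyL (Submodule.subset_span hw)⟩) hw

end SubmonoidLattice

section TruncatedCone

variable {E : Type*} [NormedAddCommGroup E] [NormedSpace ℝ E] {deg : E →ₗ[ℝ] ℝ} {s : Set E}

/-- The part of degree at most `1` of the cone generated by `s`. The elements of degree at most `n`
of a monoid lie in `n` times its truncated cone. -/
def truncatedCone (deg : E →ₗ[ℝ] ℝ) (s : Set E) : Set E :=
  {x | x ∈ PointedCone.hull ℝ s ∧ deg x ≤ 1}

theorem truncatedCone_mono {s t : Set E} (h : s ⊆ t) :
    truncatedCone deg s ⊆ truncatedCone deg t :=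
  fun _ hx => ⟨Submodule.span_mono h hx.1, hx.2⟩

theorem convex_truncatedCone : Convex ℝ (truncatedCone deg s) :=
  (PointedCone.convex _).inter (convex_halfSpace_le deg.isLinear 1)

theorem norm_le_of_mem_hull (hdeg : ∀ x ∈ s, ‖x‖ ≤ deg x) {x : E}
    (hx : x ∈ PointedCone.hull ℝ s) : ‖x‖ ≤ deg x := by
  induction hx using Submodule.span_induction with
  | mem x hx => exact hdeg x hx
  | zero => simp
  | add x y _ _ hx hy =>
    rw [map_add]
    exact (norm_add_le x y).trans (add_le_add hx hy)
  | smul c x _ hx =>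
    rw [Nonneg.mk_smul, map_smul, norm_smul, Real.norm_of_nonneg c.2]
    exact mul_le_mul_of_nonneg_left hx c.2

theorem truncatedCone_subset_closedBall (hdeg : ∀ x ∈ s, ‖x‖ ≤ deg x) :
    truncatedCone deg s ⊆ Metric.closedBall 0 1 := fun _ hx =>
  mem_closedBall_zero_iff.2 ((norm_le_of_mem_hull hdeg hx.1).trans hx.2)

theorem isBounded_truncatedCone (hdeg : ∀ x ∈ s, ‖x‖ ≤ deg x) :
    Bornology.IsBounded (truncatedCone deg s) :=
  Metric.isBounded_closedBall.subset (truncatedCone_subset_closedBall hdeg)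

theorem truncatedCone_eq_iUnion (deg : E →ₗ[ℝ] ℝ) (s : Set E) :
    truncatedCone deg s = ⋃ F : Finset s, truncatedCone deg (F.map (.subtype _) : Finset E) := by
  classical
  refine subset_antisymm (fun x hx => ?_)
    (Set.iUnion_subset fun F => truncatedCone_mono (by simp))
  obtain ⟨F, hFs, hxF⟩ := Submodule.mem_span_finite_of_mem_span hx.1
  refine Set.mem_iUnion.2 ⟨F.subtype (· ∈ s), ?_, hx.2⟩
  rwa [Finset.subtype_map_of_mem hFs]

theorem span_truncatedCone (deg : E →ₗ[ℝ] ℝ) (s : Set E) :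
    Submodule.span ℝ (truncatedCone deg s) = Submodule.span ℝ s := by
  refine le_antisymm (Submodule.span_le.2 fun x hx => ?_) (Submodule.span_le.2 fun x hx => ?_)
  · exact Submodule.span_subset_span _ ℝ s hx.1
  · rcases le_or_gt (deg x) 1 with h | h
    · exact Submodule.subset_span ⟨Submodule.subset_span hx, h⟩
    · have h0 : 0 < deg x := zero_lt_one.trans h
      rw [← smul_inv_smul₀ h0.ne' x]
      refine Submodule.smul_mem _ _ (Submodule.subset_span ⟨?_, ?_⟩)
      · exact PointedCone.smul_mem _ (inv_pos.2 h0).le (Submodule.subset_span hx)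
      · rw [map_smul, smul_eq_mul, inv_mul_cancel₀ h0.ne']

theorem interior_truncatedCone_nonempty [FiniteDimensional ℝ E] (hs : Submodule.span ℝ s = ⊤) :
    (interior (truncatedCone deg s)).Nonempty := by
  have hzero : (0 : E) ∈ truncatedCone deg s := ⟨zero_mem _, by simp⟩
  rw [convex_truncatedCone.interior_nonempty_iff_affineSpan_eq_top, ← Set.insert_eq_of_mem hzero]
  refine SetLike.coe_injective ?_
  rw [affineSpan_insert_zero, span_truncatedCone, hs]
  rfl

end TruncatedCone

section LatticeCount

open MeasureTheory
open scoped Pointwise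

variable {E : Type*} [NormedAddCommGroup E] [NormedSpace ℝ E] [FiniteDimensional ℝ E]

theorem tendsto_ncard_inter_inv_smul_of_convex {L : Submodule ℤ E} [DiscreteTopology L]
    [IsZLattice ℝ L] {ι : Type*} [Fintype ι] (b : Module.Basis ι ℤ L) {s : Set E}
    (hs : Convex ℝ s) (hbdd : Bornology.IsBounded s) :
    Tendsto (fun n : ℕ => ((s ∩ (n : ℝ)⁻¹ • (L : Set E)).ncard : ℝ) / (n : ℝ) ^ Fintype.card ι)
      atTop (𝓝 (volume.real ((b.ofZLatticeBasis ℝ).equivFun '' s))) := by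
  borelize E
  let φ := (b.ofZLatticeBasis ℝ).equivFun.toContinuousLinearEquiv
  have hfrontier : ∀ {t : Set E}, Convex ℝ t → volume (frontier (φ '' t)) = 0 := fun ht =>
    (ht.linear_image φ.toLinearMap).addHaar_frontier volume
  have hinterior := ZLattice.covolume.tendsto_card_div_pow'' b (hbdd.subset interior_subset)
    isOpen_interior.measurableSet (hfrontier hs.interior)
  have hclosure := ZLattice.covolume.tendsto_card_div_pow'' b hbdd.closure
    isClosed_closure.measurableSet (hfrontier hs.closure)
  have hvol_interior : volume.real (φ '' interior s) = volume.real (φ '' s) := by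
    rw [show φ '' interior s = _ from φ.toHomeomorph.image_interior s]
    exact measureReal_congr (interior_ae_eq_of_null_frontier (hfrontier hs))
  have hvol_closure : volume.real (φ '' closure s) = volume.real (φ '' s) := by
    rw [φ.image_closure]
    exact measureReal_congr (closure_ae_eq_of_null_frontier (hfrontier hs))
  change Tendsto _ _ (𝓝 (volume.real (φ '' interior s))) at hinterior
  change Tendsto _ _ (𝓝 (volume.real (φ '' closure s))) at hclosure
  rw [hvol_interior] at hinterior
  rw [hvol_closure] at hclosure
  have hncard_le : ∀ {t u : Set E} {n : ℕ}, t ⊆ u → Bornology.IsBounded u → n ≠ 0 →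
      ((t ∩ (n : ℝ)⁻¹ • (L : Set E)).ncard : ℝ) ≤ (u ∩ (n : ℝ)⁻¹ • (L : Set E)).ncard :=
    fun h hu hn => by
      exact_mod_cast Set.ncard_le_ncard (Set.inter_subset_inter_left _ h)
        (finite_inter_inv_smul_lattice L hu (Nat.cast_ne_zero.2 hn))
  refine tendsto_of_tendsto_of_tendsto_of_le_of_le' hinterior hclosure ?_ ?_
  · filter_upwards [eventually_ne_atTop 0] with n hn
    exact div_le_div_of_nonneg_right (hncard_le interior_subset hbdd hn) (by positivity)
  · filter_upwards [eventually_ne_atTop 0] with n hn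
    exact div_le_div_of_nonneg_right (hncard_le subset_closure hbdd.closure hn) (by positivity)

variable {deg : E →ₗ[ℝ] ℝ}

theorem exists_finset_lt_volume_truncatedCone {ι : Type*} [Fintype ι] (φ : E ≃ₗ[ℝ] (ι → ℝ))
    {s : Set E} (hs : s.Countable) (hdeg : ∀ x ∈ s, ‖x‖ ≤ deg x) {a : ℝ}
    (ha : a < volume.real (φ '' truncatedCone deg s)) :
    ∃ F : Finset E, (F : Set E) ⊆ s ∧ a < volume.real (φ '' truncatedCone deg (F : Set E)) := by
  have : Countable s := hs
  have hbdd : Bornology.IsBounded (φ '' truncatedCone deg s) :=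
    φ.toContinuousLinearEquiv.lipschitz.isBounded_image (isBounded_truncatedCone hdeg)
  have hlim := tendsto_measure_iUnion_atTop (μ := volume)
    (s := fun F : Finset s => φ '' truncatedCone deg (F.map (.subtype _) : Finset E))
    fun F G h => Set.image_mono (truncatedCone_mono (by simpa using h))
  rw [← Set.image_iUnion, ← truncatedCone_eq_iUnion] at hlim
  obtain ⟨F, hF⟩ := (((ENNReal.tendsto_toReal hbdd.measure_lt_top.ne).comp hlim).eventually
    (lt_mem_nhds ha)).exists
  exact ⟨F.map (.subtype _), by simp, hF⟩

theorem volume_truncatedCone_pos {ι : Type*} [Fintype ι] (φ : E ≃ₗ[ℝ] (ι → ℝ)) {s : Set E}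
    (hs : Submodule.span ℝ s = ⊤) (hdeg : ∀ x ∈ s, ‖x‖ ≤ deg x) :
    0 < volume.real (φ '' truncatedCone deg s) := by
  have hbdd : Bornology.IsBounded (φ '' truncatedCone deg s) :=
    φ.toContinuousLinearEquiv.lipschitz.isBounded_image (isBounded_truncatedCone hdeg)
  refine ENNReal.toReal_pos (Measure.measure_pos_of_nonempty_interior _ ?_).ne'
    hbdd.measure_lt_top.ne
  have hint := (interior_truncatedCone_nonempty (deg := deg) hs).image φ.toContinuousLinearEquiv
  rwa [show φ.toContinuousLinearEquiv '' interior _ = _ from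
    φ.toContinuousLinearEquiv.toHomeomorph.image_interior _] at hint

variable {M : AddSubmonoid E} [DiscreteTopology (Submodule.span ℤ (M : Set E))]

theorem finite_setOf_mem_deg_le (hdeg : ∀ x ∈ M, ‖x‖ ≤ deg x) (d : ℝ) :
    {x ∈ M | deg x ≤ d}.Finite := by
  refine (finite_inter_lattice (Submodule.span ℤ (M : Set E))
    (Metric.isBounded_closedBall (x := 0) (r := d))).subset ?_
  rintro x ⟨hx, hxd⟩
  exact ⟨by simpa using (hdeg x hx).trans hxd, Submodule.subset_span hx⟩

theorem ncard_deg_le_le_ncard_truncatedCone (hdeg : ∀ x ∈ M, ‖x‖ ≤ deg x) {n : ℕ} (hn : n ≠ 0) :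
    {x ∈ M | deg x ≤ n}.ncard ≤ (truncatedCone deg (M : Set E) ∩
      (n : ℝ)⁻¹ • (Submodule.span ℤ (M : Set E) : Set E)).ncard := by
  have hn' : (0 : ℝ) < n := by positivity
  refine Set.ncard_le_ncard_of_injOn (fun x => (n : ℝ)⁻¹ • x) ?_
    (smul_right_injective E (inv_ne_zero hn'.ne')).injOn
    (finite_inter_inv_smul_lattice _ (isBounded_truncatedCone hdeg) hn'.ne')
  rintro x ⟨hx, hxn⟩
  refine ⟨⟨?_, ?_⟩, x, Submodule.subset_span hx, rfl⟩
  · exact PointedCone.smul_mem _ (inv_nonneg.2 hn'.le) (Submodule.subset_span hx)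
  · rwa [map_smul, smul_eq_mul, inv_mul_le_one₀ hn']

theorem exists_ncard_truncatedCone_le (hdeg : ∀ x ∈ M, ‖x‖ ≤ deg x) {F : Finset E}
    (hF : (F : Set E) ⊆ M) : ∃ D : ℕ, ∀ n : ℕ, n ≠ 0 →
      (truncatedCone deg (F : Set E) ∩
        (n : ℝ)⁻¹ • (Submodule.span ℤ (M : Set E) : Set E)).ncard ≤
      {x ∈ M | deg x ≤ (n + D : ℕ)}.ncard := by
  obtain ⟨x, _, hx⟩ := exists_mem_forall_add_mem_of_mem_hull hF
  refine ⟨⌈deg x⌉₊, fun n hn => ?_⟩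
  have hn' : (n : ℝ) ≠ 0 := Nat.cast_ne_zero.2 hn
  refine Set.ncard_le_ncard_of_injOn (fun y => x + (n : ℝ) • y) ?_
    ((add_right_injective x).comp (smul_right_injective E hn')).injOn
    (finite_setOf_mem_deg_le hdeg _)
  rintro y ⟨⟨hyF, hy1⟩, hyL⟩
  refine ⟨hx _ (PointedCone.smul_mem _ n.cast_nonneg hyF)
    ((Set.mem_inv_smul_set_iff₀ hn' _ _).1 hyL), ?_⟩
  rw [map_add, map_smul, smul_eq_mul, Nat.cast_add, add_comm]
  exact add_le_add (mul_le_of_le_one_right n.cast_nonneg hy1) (Nat.le_ceil _)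

theorem eventually_lt_div_pow_of_le_add {u v : ℕ → ℕ} {r D : ℕ} {c a : ℝ}
    (hu : Tendsto (fun n : ℕ => (u n : ℝ) / (n : ℝ) ^ r) atTop (𝓝 c)) (ha : a < c)
    (h : ∀ n, n ≠ 0 → u n ≤ v (n + D)) : ∀ᶠ n : ℕ in atTop, a < (v n : ℝ) / (n : ℝ) ^ r := by
  have hratio : Tendsto (fun n : ℕ => ((n : ℝ) / (n + D)) ^ r) atTop (𝓝 1) := by
    simpa using (tendsto_natCast_div_add_atTop (𝕜 := ℝ) (D : ℝ)).pow r
  have hprod := hu.mul hratio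
  rw [mul_one] at hprod
  rw [← map_add_atTop_eq_nat D, eventually_map]
  filter_upwards [hprod.eventually (lt_mem_nhds ha), eventually_ne_atTop 0] with n hn hn0
  refine hn.trans_le ?_
  rw [div_pow, div_mul_div_cancel₀ (by positivity), Nat.cast_add]
  refine div_le_div_of_nonneg_right ?_ (by positivity)
  exact_mod_cast h n hn0

theorem exists_tendsto_ncard_deg_le [IsZLattice ℝ (Submodule.span ℤ (M : Set E))]
    (hdeg : ∀ x ∈ M, ‖x‖ ≤ deg x) :
    ∃ c : ℝ, 0 < c ∧ Tendsto (fun n : ℕ => ({x ∈ M | deg x ≤ n}.ncard : ℝ) /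
      (n : ℝ) ^ Module.finrank ℝ E) atTop (𝓝 c) := by
  set L := Submodule.span ℤ (M : Set E) with hL
  have : Module.Finite ℤ L := ZLattice.module_finite ℝ L
  have : Module.Free ℤ L := ZLattice.module_free ℝ L
  have : Countable L := inferInstance
  have hcountable : (M : Set E).Countable :=
    (Set.to_countable (L : Set E)).mono Submodule.subset_span
  have hspan : Submodule.span ℝ (M : Set E) = ⊤ := by
    rw [← Submodule.span_span_of_tower ℤ, ← hL, IsZLattice.span_top]
  let b := Module.Free.chooseBasis ℤ L
  let φ := (b.ofZLatticeBasis ℝ).equivFun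
  refine ⟨volume.real (φ '' truncatedCone deg (M : Set E)), volume_truncatedCone_pos φ hspan hdeg,
    tendsto_order.2 ⟨fun a ha => ?_, fun a ha => ?_⟩⟩ <;>
    rw [← ZLattice.rank ℝ L, Module.finrank_eq_card_chooseBasisIndex]
  · obtain ⟨F, hFM, haF⟩ := exists_finset_lt_volume_truncatedCone φ hcountable hdeg ha
    obtain ⟨D, hD⟩ := exists_ncard_truncatedCone_le hdeg hFM
    exact eventually_lt_div_pow_of_le_add (v := fun n => {x ∈ M | deg x ≤ n}.ncard)
      (tendsto_ncard_inter_inv_smul_of_convex b convex_truncatedCone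
        (isBounded_truncatedCone fun x hx => hdeg x (hFM hx))) haF hD
  · filter_upwards [(tendsto_ncard_inter_inv_smul_of_convex b convex_truncatedCone
      (isBounded_truncatedCone hdeg)).eventually (gt_mem_nhds ha), eventually_ne_atTop 0]
      with n hn hn0
    refine lt_of_le_of_lt (div_le_div_of_nonneg_right ?_ (by positivity)) hn
    exact_mod_cast ncard_deg_le_le_ncard_truncatedCone hdeg hn0

end LatticeCount

section ExponentVectors

variable {σ : Type*}

/-- An exponent vector, viewed as a real vector. -/
noncomputable def realExponent (σ : Type*) : (σ →₀ ℕ) →+ (σ → ℝ) where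
  toFun a i := a i
  map_zero' := by ext; simp
  map_add' a b := by ext; simp

@[simp]
theorem realExponent_apply (a : σ →₀ ℕ) (i : σ) : realExponent σ a i = a i := rfl

theorem realExponent_injective : Function.Injective (realExponent σ) := fun a b h => by
  ext i
  have hi := congrFun h i
  rw [realExponent_apply, realExponent_apply] at hi
  exact_mod_cast hi

/-- The real vector space spanned by a monoid of exponent vectors. Its dimension is the common
value of the dimensions of the monomial algebra. -/
noncomputable def exponentSpan (M : AddSubmonoid (σ →₀ ℕ)) : Submodule ℝ (σ → ℝ) :=
  Submodule.span ℝ (realExponent σ '' M)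

/-- A monoid of exponent vectors, viewed inside the real vector space that it spans. -/
noncomputable def realMonoid (M : AddSubmonoid (σ →₀ ℕ)) : AddSubmonoid (exponentSpan M) :=
  (M.map (realExponent σ)).comap (exponentSpan M).subtype.toAddMonoidHom

theorem mem_realMonoid {M : AddSubmonoid (σ →₀ ℕ)} {x : exponentSpan M} :
    x ∈ realMonoid M ↔ ∃ a ∈ M, realExponent σ a = x := Iff.rfl

theorem ncard_setOf_degree_le_eq_sum [Finite σ] (M : AddSubmonoid (σ →₀ ℕ)) (N : ℕ) :
    {a ∈ M | a.degree ≤ N}.ncard = ∑ i ∈ Finset.range (N + 1), {a ∈ M | a.degree = i}.ncard := by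
  have hunion : {a ∈ M | a.degree ≤ N} =
      ⋃ i ∈ (Finset.range (N + 1) : Set ℕ), {a ∈ M | a.degree = i} := by
    ext a
    simp [and_comm]
  rw [hunion, (Finset.finite_toSet _).ncard_biUnion
    (fun i _ => (Finsupp.finite_of_degree_eq i).subset fun a ha => ha.2)
    (fun i _ j _ hij => Set.disjoint_left.2 fun a hi hj => hij (hi.2.symm.trans hj.2)),
    finsum_mem_coe_finset]

variable {M : AddSubmonoid (σ →₀ ℕ)}

instance discreteTopology_span_realMonoid [Finite σ] :
    DiscreteTopology (Submodule.span ℤ (realMonoid M : Set (exponentSpan M))) := by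
  have := Fintype.ofFinite σ
  have hle : (Submodule.span ℤ (realMonoid M : Set (exponentSpan M)) : Set (exponentSpan M)) ⊆
      Subtype.val ⁻¹' (Submodule.span ℤ (Set.range (Pi.basisFun ℝ σ)) : Set (σ → ℝ)) := by
    refine (Submodule.span_le (p := (Submodule.span ℤ (Set.range (Pi.basisFun ℝ σ))).comap
      ((exponentSpan M).subtype.restrictScalars ℤ))).2 fun x hx => ?_
    obtain ⟨a, -, ha⟩ := mem_realMonoid.1 hx
    refine (Module.Basis.mem_span_iff_repr_mem ..).2 fun i => ⟨a i, ?_⟩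
    simp [← ha]
  have : DiscreteTopology (Submodule.span ℤ (Set.range (Pi.basisFun ℝ σ)) : Set (σ → ℝ)) :=
    inferInstanceAs (DiscreteTopology (Submodule.span ℤ (Set.range (Pi.basisFun ℝ σ))))
  have : DiscreteTopology (Subtype.val ⁻¹'
      (Submodule.span ℤ (Set.range (Pi.basisFun ℝ σ)) : Set (σ → ℝ)) : Set (exponentSpan M)) :=
    DiscreteTopology.preimage_of_continuous_injective _ continuous_subtype_val
      Subtype.val_injective
  exact DiscreteTopology.of_subset this hle

instance isZLattice_span_realMonoid [Fintype σ] :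
    IsZLattice ℝ (Submodule.span ℤ (realMonoid M : Set (exponentSpan M))) where
  span_top := by
    rw [Submodule.span_span_of_tower]
    exact Submodule.span_span_coe_preimage

/-- The total degree as a linear functional. -/
noncomputable def degreeFunctional [Fintype σ] (M : AddSubmonoid (σ →₀ ℕ)) :
    exponentSpan M →ₗ[ℝ] ℝ :=
  (∑ i, LinearMap.proj i) ∘ₗ (exponentSpan M).subtype

theorem degreeFunctional_eq [Fintype σ] {x : exponentSpan M} {a : σ →₀ ℕ}
    (h : realExponent σ a = x) :
    degreeFunctional M x = a.degree := by
  simp [degreeFunctional, ← h, Finsupp.degree_eq_sum]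

theorem norm_le_degreeFunctional [Fintype σ] {x : exponentSpan M} (hx : x ∈ realMonoid M) :
    ‖x‖ ≤ degreeFunctional M x := by
  obtain ⟨a, -, ha⟩ := mem_realMonoid.1 hx
  rw [degreeFunctional_eq ha, Submodule.coe_norm, ← ha, pi_norm_le_iff_of_nonneg (by positivity)]
  intro i
  rw [realExponent_apply, Real.norm_natCast]
  exact_mod_cast Finsupp.le_degree i a

theorem ncard_realMonoid_degree_le [Fintype σ] (M : AddSubmonoid (σ →₀ ℕ)) (N : ℕ) :
    {x ∈ realMonoid M | degreeFunctional M x ≤ N}.ncard = {a ∈ M | a.degree ≤ N}.ncard := by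
  rw [← Set.ncard_image_of_injective _ realExponent_injective,
    ← Set.ncard_image_of_injective _ (Subtype.val_injective (p := (· ∈ exponentSpan M)))]
  congr 1
  ext y
  constructor
  · rintro ⟨x, ⟨hx, hxN⟩, rfl⟩
    obtain ⟨a, haM, ha⟩ := mem_realMonoid.1 hx
    rw [degreeFunctional_eq ha] at hxN
    exact ⟨a, ⟨haM, by exact_mod_cast hxN⟩, ha⟩
  · rintro ⟨a, ⟨haM, haN⟩, rfl⟩
    refine ⟨⟨realExponent σ a, Submodule.subset_span ⟨a, haM, rfl⟩⟩, ⟨⟨a, haM, rfl⟩, ?_⟩, rfl⟩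
    rw [degreeFunctional_eq (a := a) rfl]
    exact_mod_cast haN

theorem exists_tendsto_ncard_degree_le [Finite σ] (M : AddSubmonoid (σ →₀ ℕ)) :
    ∃ c : ℝ, 0 < c ∧ Tendsto (fun N : ℕ => ({a ∈ M | a.degree ≤ N}.ncard : ℝ) /
      (N : ℝ) ^ Module.finrank ℝ (exponentSpan M)) atTop (𝓝 c) := by
  have := Fintype.ofFinite σ
  simpa only [ncard_realMonoid_degree_le] using
    exists_tendsto_ncard_deg_le (M := realMonoid M) (deg := degreeFunctional M)
      fun _ hx => norm_le_degreeFunctional hx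

end ExponentVectors

section MonomialSubalgebra

open MvPolynomial
open scoped Pointwise

variable {σ : Type*}

/-- The algebra spanned by the monomials with exponent in `M`, that is, the monoid algebra of `M`
inside the polynomial ring. -/
noncomputable def monomialSubalgebra (R : Type*) [CommSemiring R] (M : AddSubmonoid (σ →₀ ℕ)) :
    Subalgebra R (MvPolynomial σ R) :=
  (restrictSupport R (M : Set (σ →₀ ℕ))).toSubalgebra
    ((monomial_mem_restrictSupport R).2 (Or.inl M.zero_mem)) fun p q hp hq => by
      have hpq := Submodule.mul_mem_mul hp hq
      rw [← restrictSupport_add] at hpq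
      exact restrictSupport_mono R (Set.add_subset_iff.2 fun _ ha _ hb => M.add_mem ha hb) hpq

theorem mem_monomialSubalgebra {R : Type*} [CommSemiring R] {M : AddSubmonoid (σ →₀ ℕ)}
    {p : MvPolynomial σ R} :
    p ∈ monomialSubalgebra R M ↔ (p.support : Set (σ →₀ ℕ)) ⊆ M := Iff.rfl

theorem monomial_mem_monomialSubalgebra {R : Type*} [CommSemiring R] {M : AddSubmonoid (σ →₀ ℕ)}
    {a : σ →₀ ℕ} (ha : a ∈ M) (c : R) : monomial a c ∈ monomialSubalgebra R M :=
  (monomial_mem_restrictSupport R).2 (Or.inl ha)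

theorem adjoin_monomial_eq_monomialSubalgebra (R : Type*) [CommSemiring R]
    (E : Set (σ →₀ ℕ)) :
    Algebra.adjoin R ((fun e => monomial e (1 : R)) '' E) =
      monomialSubalgebra R (AddSubmonoid.closure E) := by
  refine le_antisymm (Algebra.adjoin_le ?_) fun p hp => ?_
  · rintro _ ⟨e, he, rfl⟩
    exact monomial_mem_monomialSubalgebra (AddSubmonoid.subset_closure he) 1
  · rw [← Subalgebra.mem_toSubmodule]
    refine (restrictSupport_eq_span R _).trans_le (Submodule.span_le.2 ?_) hp
    rintro _ ⟨a, ha, rfl⟩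
    induction ha using AddSubmonoid.closure_induction with
    | mem e he => exact Algebra.subset_adjoin ⟨e, he, rfl⟩
    | zero => exact one_mem (Algebra.adjoin R _)
    | add a b _ _ ha hb =>
      simpa [monomial_mul] using mul_mem (S := Subalgebra R _) ha hb

variable {k : Type*} [Field k]

theorem finiteDimensional_comap_restrictSupport (S : Subalgebra k (MvPolynomial σ k))
    {s : Set (σ →₀ ℕ)} (hs : s.Finite) :
    FiniteDimensional k ((restrictSupport k s).comap S.val.toLinearMap) := by
  have := hs.to_subtype
  have : FiniteDimensional k (restrictSupport k s) := .of_basis (basisRestrictSupport k s)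
  exact Module.Finite.iff_fg.2 (Submodule.fg_of_fg_map_injective S.val.toLinearMap
    Subtype.val_injective (Submodule.FG.of_le (Module.Finite.iff_fg.1 this)
      (Submodule.map_comap_le _ _)))

theorem finrank_comap_restrictSupport (M : AddSubmonoid (σ →₀ ℕ)) (s : Set (σ →₀ ℕ)) :
    Module.finrank k ((restrictSupport k s).comap (monomialSubalgebra k M).val.toLinearMap)
      = ((M : Set (σ →₀ ℕ)) ∩ s).ncard := by
  have hmap : ((restrictSupport k s).comap (monomialSubalgebra k M).val.toLinearMap).map
      (monomialSubalgebra k M).val.toLinearMap = restrictSupport k ((M : Set (σ →₀ ℕ)) ∩ s) := by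
    ext p
    rw [mem_restrictSupport_iff, Set.subset_inter_iff]
    exact ⟨fun ⟨q, hq, hqp⟩ => hqp ▸ ⟨q.2, hq⟩, fun ⟨hp, hps⟩ => ⟨⟨p, hp⟩, hps, rfl⟩⟩
  rw [(Submodule.equivMapOfInjective (monomialSubalgebra k M).val.toLinearMap
    Subtype.val_injective _).finrank_eq, hmap,
    Module.finrank_eq_nat_card_basis (basisRestrictSupport k _)]
  rfl

theorem powerSum_le_restrictTotalDegree {S : Subalgebra k (MvPolynomial σ k)} {V : Submodule k S}
    {D : ℕ} (hV : V ≤ (restrictTotalDegree σ k D).comap S.val.toLinearMap) (N : ℕ) :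
    powerSum V N ≤ (restrictTotalDegree σ k (D * N)).comap S.val.toLinearMap := by
  have hpow : ∀ i, V ^ i ≤ (restrictTotalDegree σ k (D * i)).comap S.val.toLinearMap := by
    intro i
    induction i with
    | zero =>
      rw [pow_zero, Submodule.one_le]
      simp [mem_restrictTotalDegree]
    | succ i ih =>
      rw [pow_succ, Submodule.mul_le]
      intro x hx y hy
      have hxi := (mem_restrictTotalDegree _ _ _).1 (ih hx)
      have hyD := (mem_restrictTotalDegree _ _ _).1 (hV hy)
      exact (mem_restrictTotalDegree _ _ _).2
        ((totalDegree_mul x.1 y.1).trans (add_le_add hxi hyD))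
  refine Finset.sum_induction _ (· ≤ _) (fun _ _ => sup_le) bot_le fun i hi => ?_
  refine (hpow i).trans (Submodule.comap_mono (restrictSupport_mono k fun a ha => ?_))
  exact le_trans ha (Nat.mul_le_mul_left D (Nat.lt_succ_iff.1 (Finset.mem_range.1 hi)))

theorem exists_le_restrictTotalDegree {S : Subalgebra k (MvPolynomial σ k)} {V : Submodule k S}
    (hV : V.FG) :
    ∃ D : ℕ, 0 < D ∧ V ≤ (restrictTotalDegree σ k D).comap S.val.toLinearMap := by
  obtain ⟨t, rfl⟩ := hV
  refine ⟨t.sup (fun x => x.1.totalDegree) + 1, Nat.succ_pos _, Submodule.span_le.2 fun x hx => ?_⟩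
  exact (mem_restrictTotalDegree _ _ _).2
    ((Finset.le_sup (f := fun x : S => x.1.totalDegree) hx).trans (Nat.le_succ _))

variable [Finite σ]

theorem exists_finrank_powerSum_le {M : AddSubmonoid (σ →₀ ℕ)}
    {V : Submodule k (monomialSubalgebra k M)} (hV : V.FG) : ∃ D : ℕ, 0 < D ∧ ∀ N,
      Module.finrank k (powerSum V N) ≤ {a ∈ M | a.degree ≤ D * N}.ncard := by
  obtain ⟨D, hD, hVD⟩ := exists_le_restrictTotalDegree hV
  refine ⟨D, hD, fun N => ?_⟩
  have : FiniteDimensional k ((restrictTotalDegree σ k (D * N)).comap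
      (monomialSubalgebra k M).val.toLinearMap) :=
    finiteDimensional_comap_restrictSupport _ (Finsupp.finite_of_degree_le (D * N))
  exact (Submodule.finrank_mono (powerSum_le_restrictTotalDegree hVD N)).trans_eq
    (finrank_comap_restrictSupport M _)

theorem gkDim_monomialSubalgebra_le (k : Type*) [Field k] (M : AddSubmonoid (σ →₀ ℕ)) :
    gkDim k (monomialSubalgebra k M) ≤ Module.finrank ℝ (exponentSpan M) := by
  refine gkDim_le_of_eventually_le fun V hV => ?_
  obtain ⟨D, hD, hle⟩ := exists_finrank_powerSum_le (Module.Finite.iff_fg.1 hV)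
  obtain ⟨c, -, hlim⟩ := exists_tendsto_ncard_degree_le M
  set r := Module.finrank ℝ (exponentSpan M)
  have hmul : Tendsto (fun N : ℕ => D * N) atTop atTop := tendsto_id.const_mul_atTop' hD
  refine ⟨(c + 1) * D ^ r, ?_⟩
  filter_upwards [(hlim.comp hmul).eventually (gt_mem_nhds (lt_add_one c)),
    eventually_ne_atTop 0] with N hN hN0
  rw [Function.comp_apply, div_lt_iff₀ (by positivity)] at hN
  calc (Module.finrank k (powerSum V N) : ℝ)
      ≤ ({a ∈ M | a.degree ≤ D * N}.ncard : ℝ) := by exact_mod_cast hle N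
    _ ≤ (c + 1) * ((D * N : ℕ) : ℝ) ^ r := hN.le
    _ = (c + 1) * D ^ r * (N : ℝ) ^ r := by push_cast; ring

end MonomialSubalgebra

section StandardGrading

open MvPolynomial

theorem iSupIndep_comap {ι R N P : Type*} [Ring R] [AddCommGroup N] [AddCommGroup P] [Module R N]
    [Module R P] {p : ι → Submodule R P} (hp : iSupIndep p) {f : N →ₗ[R] P}
    (hf : Function.Injective f) : iSupIndep fun i => (p i).comap f := by
  refine iSupIndep_def.2 fun i => Submodule.disjoint_def.2 fun x hx hx' => hf ?_
  rw [map_zero]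
  refine Submodule.disjoint_def.1 (iSupIndep_def.1 hp i) (f x) hx ?_
  exact iSup₂_le (a := (⨆ j, ⨆ _ : j ≠ i, p j).comap f)
    (fun j hj => Submodule.comap_mono (le_iSup₂_of_le j hj le_rfl)) hx'

variable {k : Type*} [Field k] {n : ℕ}

theorem gradedMonoid_standardGrading (S : Subalgebra k (MvPolynomial (Fin n) k)) :
    SetLike.GradedMonoid (standardGrading S) where
  one_mem := isHomogeneous_one (Fin n) k
  mul_mem _ _ _ _ hx hy := IsHomogeneous.mul hx hy

theorem standardGrading_zero (S : Subalgebra k (MvPolynomial (Fin n) k)) :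
    standardGrading S 0 = 1 := by
  ext x
  rw [standardGrading, homogeneousSubmodule_zero, Submodule.mem_comap, Submodule.mem_one,
    Submodule.mem_one]
  refine exists_congr fun a => ?_
  rw [Subtype.ext_iff]
  rfl

theorem standardGrading_eq_comap_restrictSupport (S : Subalgebra k (MvPolynomial (Fin n) k))
    (i : ℕ) : standardGrading S i =
      (restrictSupport k {a | a.degree = i}).comap S.val.toLinearMap := by
  rw [standardGrading, homogeneousSubmodule_eq_finsupp_supported]
  rfl

theorem finiteDimensional_standardGrading (S : Subalgebra k (MvPolynomial (Fin n) k)) (i : ℕ) :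
    FiniteDimensional k (standardGrading S i) := by
  rw [standardGrading_eq_comap_restrictSupport]
  exact finiteDimensional_comap_restrictSupport S (Finsupp.finite_of_degree_eq i)

theorem isInternal_standardGrading {S : Subalgebra k (MvPolynomial (Fin n) k)}
    (hS : ∀ p ∈ S, ∀ i, homogeneousComponent i p ∈ S) :
    DirectSum.IsInternal (standardGrading S) := by
  have hindep : iSupIndep (homogeneousSubmodule (Fin n) k) := by
    let := gradedAlgebra (σ := Fin n) (R := k)
    exact (DirectSum.Decomposition.isInternal (homogeneousSubmodule (Fin n) k)).submodule_iSupIndep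
  refine DirectSum.isInternal_submodule_of_iSupIndep_of_iSup_eq_top
    (iSupIndep_comap hindep Subtype.val_injective) (eq_top_iff.2 fun x _ => ?_)
  have hx : x = ∑ i ∈ Finset.range (x.1.totalDegree + 1),
      (⟨homogeneousComponent i x.1, hS x.1 x.2 i⟩ : S) := by
    refine Subtype.ext ?_
    rw [AddSubmonoidClass.coe_finsetSum]
    exact (sum_homogeneousComponent x.1).symm
  rw [hx]
  exact Submodule.sum_mem _ fun i _ => Submodule.mem_iSup_of_mem i
    (homogeneousComponent_isHomogeneous i x.1)

theorem homogeneousComponent_mem_monomialSubalgebra {σ R : Type*} [CommSemiring R]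
    {M : AddSubmonoid (σ →₀ ℕ)} {p : MvPolynomial σ R} (hp : p ∈ monomialSubalgebra R M) (i : ℕ) :
    homogeneousComponent i p ∈ monomialSubalgebra R M := by
  refine mem_monomialSubalgebra.2 fun a ha => mem_monomialSubalgebra.1 hp ?_
  simp only [SetLike.mem_coe, mem_support_iff, coeff_homogeneousComponent] at ha ⊢
  exact fun h => ha (by simp [h])

theorem finrank_standardGrading_monomialSubalgebra (M : AddSubmonoid (Fin n →₀ ℕ)) (i : ℕ) :
    Module.finrank k (standardGrading (monomialSubalgebra k M) i)
      = {a ∈ M | a.degree = i}.ncard := by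
  rw [standardGrading_eq_comap_restrictSupport]
  exact finrank_comap_restrictSupport M _

end StandardGrading

section PrimeChain

open MvPolynomial

variable {σ R : Type*} [CommRing R]

/-- The monomial map from the polynomial ring to the group algebra of a quotient of the real
vector space of exponents. -/
noncomputable def toQuotientAlgebra (R : Type*) [CommRing R] (W : Submodule ℝ (σ → ℝ)) :
    MvPolynomial σ R →ₐ[R] AddMonoidAlgebra R ((σ → ℝ) ⧸ W) :=
  AddMonoidAlgebra.mapDomainAlgHom R R (W.mkQ.toAddMonoidHom.comp (realExponent σ))

theorem toQuotientAlgebra_monomial (W : Submodule ℝ (σ → ℝ)) (a : σ →₀ ℕ) :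
    toQuotientAlgebra R W (monomial a 1) = AddMonoidAlgebra.single (W.mkQ (realExponent σ a)) 1 :=
  AddMonoidAlgebra.mapDomain_single

theorem toQuotientAlgebra_eq_zero_of_le {W W' : Submodule ℝ (σ → ℝ)} (h : W ≤ W')
    {p : MvPolynomial σ R} (hp : toQuotientAlgebra R W p = 0) : toQuotientAlgebra R W' p = 0 := by
  have hcomp : toQuotientAlgebra R W' = (AddMonoidAlgebra.mapDomainAlgHom R R
      (Submodule.factor h).toAddMonoidHom).comp (toQuotientAlgebra R W) := by
    rw [toQuotientAlgebra, toQuotientAlgebra, ← AddMonoidAlgebra.mapDomainAlgHom_comp]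
    rfl
  rw [hcomp, AlgHom.comp_apply, hp, map_zero]

theorem noZeroDivisors_addMonoidAlgebra (R V : Type*) [Semiring R] [NoZeroDivisors R]
    [AddCommGroup V] [Module ℝ V] : NoZeroDivisors (AddMonoidAlgebra R V) := by
  have : Module ℚ V := Module.compHom _ (algebraMap ℚ ℝ)
  infer_instance

variable [IsDomain R] {S : Subalgebra R (MvPolynomial σ R)}

/-- The prime of `S` obtained by identifying monomials whose exponents agree modulo `W`. -/
noncomputable def quotientPrime (S : Subalgebra R (MvPolynomial σ R)) (W : Submodule ℝ (σ → ℝ)) :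
    PrimeSpectrum S :=
  have := noZeroDivisors_addMonoidAlgebra R ((σ → ℝ) ⧸ W)
  ⟨RingHom.ker ((toQuotientAlgebra R W).comp S.val), RingHom.ker_isPrime _⟩

theorem mem_quotientPrime {W : Submodule ℝ (σ → ℝ)} {x : S} :
    x ∈ (quotientPrime S W).asIdeal ↔ toQuotientAlgebra R W x.1 = 0 := Iff.rfl

theorem monomial_sub_one_mem_quotientPrime {W : Submodule ℝ (σ → ℝ)} {a : σ →₀ ℕ}
    (ha : monomial a (1 : R) ∈ S) :
    (⟨monomial a 1, ha⟩ - 1 : S) ∈ (quotientPrime S W).asIdeal ↔ realExponent σ a ∈ W := by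
  rw [mem_quotientPrime, AddSubgroupClass.coe_sub, map_sub, sub_eq_zero,
    toQuotientAlgebra_monomial, OneMemClass.coe_one, map_one, AddMonoidAlgebra.one_def,
    (AddMonoidAlgebra.single_left_injective one_ne_zero).eq_iff, Submodule.mkQ_apply,
    Submodule.Quotient.mk_eq_zero]

theorem quotientPrime_lt {W W' : Submodule ℝ (σ → ℝ)} (h : W ≤ W') {a : σ →₀ ℕ}
    (ha : monomial a (1 : R) ∈ S) (haW : realExponent σ a ∉ W) (haW' : realExponent σ a ∈ W') :
    quotientPrime S W < quotientPrime S W' := by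
  rw [← PrimeSpectrum.asIdeal_lt_asIdeal]
  refine lt_of_le_of_ne (fun x hx => toQuotientAlgebra_eq_zero_of_le h hx) fun heq => haW ?_
  rwa [← monomial_sub_one_mem_quotientPrime ha, heq, monomial_sub_one_mem_quotientPrime ha]

theorem natCast_le_ringKrullDim_of_linearIndependent {r : ℕ} {m : Fin r → (σ →₀ ℕ)}
    (hm : LinearIndependent ℝ fun i => realExponent σ (m i))
    (hmS : ∀ i, monomial (m i) (1 : R) ∈ S) : r ≤ ringKrullDim S := by
  let W : ℕ → Submodule ℝ (σ → ℝ) := fun j =>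
    Submodule.span ℝ ((fun i => realExponent σ (m i)) '' {i : Fin r | i.1 < j})
  have hmono : StrictMono fun j : Fin (r + 1) => quotientPrime S (W j) := by
    refine Fin.strictMono_iff_lt_succ.2 fun i => quotientPrime_lt ?_ (hmS i) ?_ ?_
    · exact Submodule.span_mono (Set.image_mono fun j hj => Nat.lt_succ_of_lt hj)
    · exact hm.notMem_span_image (s := {j : Fin r | j.1 < i.1}) (lt_irrefl i.1)
    · exact Submodule.subset_span ⟨i, Nat.lt_succ_self i, rfl⟩
  exact Order.LTSeries.length_le_krullDim (LTSeries.mk r _ hmono)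

theorem finrank_exponentSpan_le_ringKrullDim (R : Type*) [CommRing R] [IsDomain R] [Finite σ]
    (M : AddSubmonoid (σ →₀ ℕ)) :
    Module.finrank ℝ (exponentSpan M) ≤ ringKrullDim (monomialSubalgebra R M) := by
  obtain ⟨f, hf, -, hli⟩ := Submodule.exists_fun_fin_finrank_span_eq ℝ (realExponent σ '' M)
  choose m hm hmf using hf
  obtain rfl : (fun i => realExponent σ (m i)) = f := funext hmf
  exact natCast_le_ringKrullDim_of_linearIndependent hli fun i =>
    monomial_mem_monomialSubalgebra (hm i) 1

end PrimeChain

section HilbertSerre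

variable {n : ℕ}

theorem exists_tendsto_sum_finrank_standardGrading_div_pow (k : Type*) [Field k]
    (M : AddSubmonoid (Fin n →₀ ℕ)) :
    ∃ c : ℝ, 0 < c ∧ Tendsto (fun N : ℕ => (∑ i ∈ Finset.range (N + 1),
      (Module.finrank k (standardGrading (monomialSubalgebra k M) i) : ℝ)) /
        (N : ℝ) ^ Module.finrank ℝ (exponentSpan M)) atTop (𝓝 c) := by
  simpa only [ncard_setOf_degree_le_eq_sum, Nat.cast_sum,
    finrank_standardGrading_monomialSubalgebra] using exists_tendsto_ncard_degree_le M

theorem one_le_poincareRadius_monomialSubalgebra (k : Type*) [Field k]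
    (M : AddSubmonoid (Fin n →₀ ℕ)) :
    1 ≤ poincareRadius (standardGrading (monomialSubalgebra k M)) := by
  obtain ⟨c, -, hlim⟩ := exists_tendsto_sum_finrank_standardGrading_div_pow k M
  refine one_le_radius_ofScalars fun t ht₀ ht₁ => ?_
  simpa only [Real.norm_natCast] using
    summable_mul_pow_of_tendsto_sum_div_pow (fun _ => Nat.cast_nonneg _) hlim ht₀ ht₁

theorem poleBounds_monomialSubalgebra (k : Type*) [Field k] (M : AddSubmonoid (Fin n →₀ ℕ)) :
    poleBounds (standardGrading (monomialSubalgebra k M)) =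
      Set.Ici (Module.finrank ℝ (exponentSpan M)) := by
  obtain ⟨c, hc, hlim⟩ := exists_tendsto_sum_finrank_standardGrading_div_pow k M
  exact Set.ext <| exists_tendsto_one_sub_pow_mul_iff (by positivity)
    (tendsto_one_sub_pow_mul_tsum_of_sum (fun _ => Nat.cast_nonneg _) hlim)

theorem hilbertSerreDim_monomialSubalgebra (k : Type*) [Field k] (M : AddSubmonoid (Fin n →₀ ℕ)) :
    hilbertSerreDim (standardGrading (monomialSubalgebra k M)) =
      Module.finrank ℝ (exponentSpan M) := by
  rw [hilbertSerreDim, poleBounds_monomialSubalgebra, csInf_Ici]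

theorem isHilbertSerre_monomialSubalgebra (k : Type*) [Field k] (M : AddSubmonoid (Fin n →₀ ℕ)) :
    IsHilbertSerre (standardGrading (monomialSubalgebra k M)) where
  nontrivial := inferInstance
  gradedMonoid := gradedMonoid_standardGrading _
  isInternal := isInternal_standardGrading fun _ hp =>
    homogeneousComponent_mem_monomialSubalgebra hp
  zero_eq := standardGrading_zero _
  finite := finiteDimensional_standardGrading _
  one_le_radius := one_le_poincareRadius_monomialSubalgebra k M
  poleBounds_nonempty := poleBounds_monomialSubalgebra k M ▸ Set.nonempty_Ici

end HilbertSerre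

theorem theorem5p4 {k : Type*} [Field k] (n : ℕ)
    (S : Subalgebra k (MvPolynomial (Fin n) k)) (hS : IsMonomialAlgebra S) :
    IsHilbertSerre (standardGrading S) ∧
      ringKrullDim S = (hilbertSerreDim (standardGrading S) : WithBot ℕ∞) ∧
      Algebra.trdeg k S = (hilbertSerreDim (standardGrading S) : Cardinal) ∧
      gkDim k S = (hilbertSerreDim (standardGrading S) : EReal) := by
  obtain ⟨E, rfl⟩ := hS
  rw [adjoin_monomial_eq_monomialSubalgebra]
  set M := AddSubmonoid.closure E
  refine ⟨isHilbertSerre_monomialSubalgebra k M, ?_⟩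
  rw [hilbertSerreDim_monomialSubalgebra]
  exact ringKrullDim_trdeg_gkDim_eq (finrank_exponentSpan_le_ringKrullDim k M)
    (gkDim_monomialSubalgebra_le k M)
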